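/- **Conventions.** Put $\mathbf{L}^1=\mathbf{L}$ and $\mathbf{L}^\partial=\mathbf{L}^{\mathrm{op}}$ for a bounded lattice $\mathbf L$. An operation $f:L^n\to L$ is a *normal lattice operator of distribution type* $(j_1,\dots,j_n;j_{n+1})\in\{1,\partial\}^{n+1}$ if, as a map $\mathbf{L}^{j_1}\times\cdots\times\mathbf{L}^{j_n}\to\mathbf{L}^{j_{n+1}}$, it distributes over finite joins (including the empty one) in each argument place. A *normal lattice expansion* $\mathbf{L}=(L,\le,\wedge,\vee,0,1,(f_j)_{j\in J})$ is a bounded lattice with a normal lattice operator $f_j$ of distribution type $\delta(j)=(j_1,\dots,j_{n(j)};j_{n(j)+1})$ for each $j\in J$. An *implicative modal lattice* is a bounded lattice with operations $\to,\Box,\Diamond$ satisfying $(a\vee b)\to c=(a\to c)\wedge(b\to c)$, $a\to(b\wedge c)=(a\to b)\wedge(a\to c)$, $(0\to a)=1=(a\to 1)$, $\Box(a\wedge b)=\Box a\wedge\Box b$, $\Box1=1$, $\Diamond(a\vee b)=\Diamond a\vee\Diamond b$, $\Diamond0=0$; it is a normal lattice expansion with $\delta(\to)=(1,\partial;\partial)$,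 $\delta(\Box)=(\partial;\partial)$, $\delta(\Diamond)=(1;1)$. *Frames.* A frame $\mathfrak F=(Z_1,Z_\partial,I,(R_j)_{j\in J})$ has nonempty sorts $Z_1,Z_\partial$, a relation $I\subseteq Z_1\times Z_\partial$ and relations $R_j\subseteq Z_{j_{n(j)+1}}\times\prod_{k=1}^{n(j)}Z_{j_k}$. Let $\perp$ be the complement of $I$ and let $U'$ be the polar with respect to $\perp$ of a subset $U$ of $Z_1$ or of $Z_\partial$. A set with $U=U''$ is called a Galois set; $\mathcal G(Z_1)$ is the complete lattice (under inclusion) of Galois sets contained in $Z_1$ (stable sets). For points $u,w$ of the same sort, $u\preceq w$ iff $\{u\}'\subseteq\{w\}'$, and $\Gamma u=\{w: u\preceq w\}$; sets of the form $\Gamma u$ are the *closed elements*. The frame is *separated* if $\preceq$ is antisymmetric on both sorts. The Galois dual of $R_j$ is given by $R_j'\vec u=(R_j\vec u)'$, where $R_j\vec u=\{w: wR_j\vec u\}$; $R_j$ is *smooth* if every section of $R'_j$ (all arguments but one fixed, in any of the $n(j)+1$ places) is a Galois set. The *full complex algebra* $\mathfrak F^+$ is $\mathcal G(Z_1)$ with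 the operations $\overline F^1_j$ defined as follows: for stable $A_1,\dots,A_{n(j)}$ let $W_k=A_k$ if $j_k=1$, $W_k=A_k'$ if $j_k=\partial$, and $V=\bigcup\{R_j\vec w: w_k\in W_k \text{ for all } k\}$; then $\overline F^1_j(\vec A)=V''$ if $j_{n(j)+1}=1$, and $\overline F^1_j(\vec A)=(V'')'$ if $j_{n(j)+1}=\partial$. *Canonical extensions.* A canonical extension of a bounded lattice $\mathbf L$ is a bounded lattice embedding $\alpha:\mathbf L\to\mathbf C$ into a complete lattice such that every element of $\mathbf C$ is both a meet of joins and a join of meets of elements of $\alpha[L]$ (density) and, calling meets of subsets of $\alpha[L]$ *closed* and joins of subsets of $\alpha[L]$ *open*, for every set $A$ of closed and every set $B$ of open elements, $\bigwedge A\le\bigvee B$ iff $\bigwedge A_1\le\bigvee B_1$ for some finite $A_1\subseteq A$, $B_1\subseteq B$ (compactness). For $f:L^n\to L$ and $u\in C^n$ put $$f^\sigma(u)=\bigvee_{k\le u\le o}\ \bigwedge\{\alpha(f(a)): a\in L^n,\ k\le\alpha(a)\le o\},\qquad f^\pi(u)=\bigwedge_{k\le u\le o}\ \bigvee\{\alpha(f(a)):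 a\in L^n,\ k\le\alpha(a)\le o\},$$ where $k$ ranges over $n$-tuples of closed elements, $o$ over $n$-tuples of open elements, and tuples are ordered (and $\alpha$ applied) coordinatewise. A *canonical extension of a normal lattice expansion* is a canonical extension $(\alpha,\mathbf C)$ of its underlying bounded lattice together with normal lattice operators $F_j$ on $\mathbf C$ of the same distribution types as the $f_j$ that extend the $f_j$ (i.e. $F_j\circ\alpha=\alpha\circ f_j$), such that $F_j=f_j^\sigma$ if $j_{n(j)+1}=1$ and $F_j=f_j^\pi$ if $j_{n(j)+1}=\partial$. **Theorem (Realizing Distribution Types).** (1) Let $\mathbf L$ be a normal lattice expansion. Define its dual frame $\mathbf L_+$ by letting $Z_1$ and $Z_\partial$ be the sets of nonempty (not necessarily proper) lattice filters and ideals of $\mathbf L$, respectively, $xIy$ iff $x\cap y=\emptyset$, and, for each $j\in J$, $$wR_j\vec u\quad\text{iff}\quad \forall a_1,\dots,a_{n(j)}\in L\ \Bigl(\bigwedge_{k=1}^{n(j)}a_k\in u_k\ \Rightarrow\ f_j(a_1,\dots,a_{n(j)})\in w\Bigr),$$ where $u_k\in Z_{j_k}$ and $w\in Z_{j_{n(j)+1}}$.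 Then $\mathbf L_+$ is separated, all its relations $R_j$ are smooth, and its full complex algebra $(\mathbf L_+)^+$, with the embedding $a\mapsto\{x\in Z_1: a\in x\}$, is a canonical extension of the normal lattice expansion $\mathbf L$; in particular, $\overline F^1_j$ is the $\sigma$-extension of $f_j$ if $j_{n(j)+1}=1$, and its $\pi$-extension if $j_{n(j)+1}=\partial$. (2) If $\mathbf L$ is an implicative modal lattice, its dual frame is moreover a *refined frame*. That is, writing $R_\Box$ for the relation of $\Box$ and $\Box_{\mathcal G}=\overline F^1_\Box$ for the operation that it generates on stable sets, and setting $R'_\Box y=(R_\Box y)'$ for $y\in Z_\partial$ and $zR''_\Box=(\{y\in Z_\partial: zR'_\Box y\})'\subseteq Z_1$ for $z\in Z_1$: - (F1) the frame is separated; - (F2) each of its three relations is increasing (with respect to $\preceq$) in the first and decreasing in every other argument place; - (F3) for each relation $R_j$ and each tuple $\vec p$ of the proper sort, $R_j\vec p$ is a closed element; - (F4) each relation is smooth; - (F5) for each $x\in Z_1$, the set $\{z\in Z_1: zR''_\Box\subseteq\Gamma x\}$ is a closed element; - (F6) for every stable set $A$, $\Box_{\mathcal G}\bigl(\bigvee_{x\in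 A}\Gamma x\bigr)\subseteq\bigvee_{x\in A}\Box_{\mathcal G}(\Gamma x)$, joins being taken in $\mathcal G(Z_1)$. -/

import Mathlib

universe u v w

/-- The two-element set of sorts `{1, ∂}`. -/
inductive Sgn : Type
  | one : Sgn
  | del : Sgn

/-- The other sort. -/
def Sgn.flip : Sgn → Sgn
  | Sgn.one => Sgn.del
  | Sgn.del => Sgn.one

/-- A distribution type `(j₁, …, jₙ; jₙ₊₁)`; the same data is the sort `(jₙ₊₁; j₁ ⋯ jₙ)`
of a frame relation. -/
structure DistType : Type where
  arity : ℕ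
  inp : Fin arity → Sgn
  out : Sgn

section Algebra

/-- The binary join of `L¹ = L` or of `L^∂ = Lᵒᵖ`, as an operation on `L`. -/
def signedSup {L : Type u} [Lattice L] : Sgn → L → L → L
  | Sgn.one => fun a b => a ⊔ b
  | Sgn.del => fun a b => a ⊓ b

/-- The empty join (bottom element) of `L¹ = L` or of `L^∂ = Lᵒᵖ`, as an element of `L`. -/
def signedBot {L : Type u} [Lattice L] [BoundedOrder L] : Sgn → L
  | Sgn.one => ⊥
  | Sgn.del => ⊤

/-- `f` is a normal lattice operator of distribution type `δ = (j₁, …, jₙ; jₙ₊₁)`: as a map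
`L^{j₁} × ⋯ × L^{jₙ} → L^{jₙ₊₁}` it distributes over finite (binary and empty) joins in each
argument place. -/
structure IsNormalOp {L : Type u} [Lattice L] [BoundedOrder L] (δ : DistType)
    (f : (Fin δ.arity → L) → L) : Prop where
  additive : ∀ (k : Fin δ.arity) (a : Fin δ.arity → L) (b c : L),
    f (Function.update a k (signedSup (δ.inp k) b c)) =
      signedSup δ.out (f (Function.update a k b)) (f (Function.update a k c))
  normal : ∀ (k : Fin δ.arity) (a : Fin δ.arity → L),
    f (Function.update a k (signedBot (δ.inp k))) = signedBot δ.out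

/-- A normal lattice expansion of similarity type `(δ j)_{j ∈ J}` on the bounded lattice `L`. -/
structure NLE {J : Type v} (δ : J → DistType) (L : Type u) [Lattice L] [BoundedOrder L] where
  op : ∀ j : J, (Fin (δ j).arity → L) → L
  isNormalOp : ∀ j : J, IsNormalOp (δ j) (op j)

/-- Implicative modal lattice structure on the bounded lattice `L`. -/
structure ImplicativeModalLattice (L : Type u) [Lattice L] [BoundedOrder L] where
  imp : L → L → L
  box : L → L
  dia : L → L
  sup_imp : ∀ a b c : L, imp (a ⊔ b) c = imp a c ⊓ imp b c
  imp_inf : ∀ a b c : L, imp a (b ⊓ c) = imp a b ⊓ imp a c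
  bot_imp : ∀ a : L, imp ⊥ a = ⊤
  imp_top : ∀ a : L, imp a ⊤ = ⊤
  box_inf : ∀ a b : L, box (a ⊓ b) = box a ⊓ box b
  box_top : box ⊤ = ⊤
  dia_sup : ∀ a b : L, dia (a ⊔ b) = dia a ⊔ dia b
  dia_bot : dia ⊥ = ⊥

/-- Indices of the operators of an implicative modal lattice. -/
inductive ModalIdx : Type
  | imp : ModalIdx
  | box : ModalIdx
  | dia : ModalIdx

/-- `δ(→) = (1, ∂; ∂)`, `δ(□) = (∂; ∂)`, `δ(◇) = (1; 1)`. -/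
def modalType : ModalIdx → DistType
  | ModalIdx.imp => ⟨2, ![Sgn.one, Sgn.del], Sgn.del⟩
  | ModalIdx.box => ⟨1, fun _ => Sgn.del, Sgn.del⟩
  | ModalIdx.dia => ⟨1, fun _ => Sgn.one, Sgn.one⟩

/-- The operators of an implicative modal lattice as a family indexed by `ModalIdx`. -/
def ImplicativeModalLattice.op {L : Type u} [Lattice L] [BoundedOrder L]
    (M : ImplicativeModalLattice L) :
    ∀ j : ModalIdx, (Fin (modalType j).arity → L) → L
  | ModalIdx.imp => fun (a : Fin 2 → L) => M.imp (a 0) (a 1)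
  | ModalIdx.box => fun (a : Fin 1 → L) => M.box (a 0)
  | ModalIdx.dia => fun (a : Fin 1 → L) => M.dia (a 0)

/-- An implicative modal lattice as a normal lattice expansion. -/
def ImplicativeModalLattice.toNLE {L : Type u} [Lattice L] [BoundedOrder L]
    (M : ImplicativeModalLattice L) : NLE modalType L where
  op := M.op
  isNormalOp := by
    intro j
    cases j with
    | imp =>
      constructor
      · intro k a b c
        change Fin 2 at k
        change Fin 2 → L at a
        fin_cases k
        · exact M.sup_imp b c (a 1)
        · exact M.imp_inf (a 0) b c
      · intro k a
        change Fin 2 at k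
        change Fin 2 → L at a
        fin_cases k
        · exact M.bot_imp (a 1)
        · exact M.imp_top (a 0)
    | box =>
      constructor
      · intro k a b c
        change Fin 1 at k
        fin_cases k
        exact M.box_inf b c
      · intro k a
        change Fin 1 at k
        fin_cases k
        exact M.box_top
    | dia =>
      constructor
      · intro k a b c
        change Fin 1 at k
        fin_cases k
        exact M.dia_sup b c
      · intro k a
        change Fin 1 at k
        fin_cases k
        exact M.dia_bot

end Algebra

section CanonicalExtension

variable {L : Type u} [Lattice L] [BoundedOrder L] {C : Type w} [CompleteLattice C]

/-- Closed elements of a completion: meets of elements of the image. -/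
def IsClosedElt (α : L → C) (c : C) : Prop := ∃ S : Set L, c = sInf (α '' S)

/-- Open elements of a completion: joins of elements of the image. -/
def IsOpenElt (α : L → C) (c : C) : Prop := ∃ S : Set L, c = sSup (α '' S)

/-- `(α, C)` is a canonical extension of the bounded lattice `L`. -/
structure IsCanonicalExtension (α : L → C) : Prop where
  injective : Function.Injective α
  map_sup : ∀ a b : L, α (a ⊔ b) = α a ⊔ α b
  map_inf : ∀ a b : L, α (a ⊓ b) = α a ⊓ α b
  map_bot : α ⊥ = ⊥
  map_top : α ⊤ = ⊤
  /-- every element is a meet of joins of elements of the image -/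
  dense_inf : ∀ c : C, ∃ T : Set C, (∀ o ∈ T, IsOpenElt α o) ∧ c = sInf T
  /-- every element is a join of meets of elements of the image -/
  dense_sup : ∀ c : C, ∃ T : Set C, (∀ k ∈ T, IsClosedElt α k) ∧ c = sSup T
  compact : ∀ A B : Set C, (∀ k ∈ A, IsClosedElt α k) → (∀ o ∈ B, IsOpenElt α o) →
    (sInf A ≤ sSup B ↔
      ∃ A₁ B₁ : Set C, A₁ ⊆ A ∧ B₁ ⊆ B ∧ A₁.Finite ∧ B₁.Finite ∧ sInf A₁ ≤ sSup B₁)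

/-- The σ-extension of an `n`-ary operation on `L` along `α`:
`f^σ(u) = ⋁ { ⋀ { f(a) | a ∈ Lⁿ, k ≤ a ≤ o } | k closed, o open, k ≤ u ≤ o }`. -/
def sigmaExt (α : L → C) {n : ℕ} (f : (Fin n → L) → L) (x : Fin n → C) : C :=
  sSup {c | ∃ k o : Fin n → C, (∀ i, IsClosedElt α (k i)) ∧ (∀ i, IsOpenElt α (o i)) ∧
    k ≤ x ∧ x ≤ o ∧
    c = sInf {d | ∃ a : Fin n → L, (∀ i, k i ≤ α (a i)) ∧ (∀ i, α (a i) ≤ o i) ∧ d = α (f a)}}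

/-- The π-extension of an `n`-ary operation on `L` along `α`:
`f^π(u) = ⋀ { ⋁ { f(a) | a ∈ Lⁿ, k ≤ a ≤ o } | k closed, o open, k ≤ u ≤ o }`. -/
def piExt (α : L → C) {n : ℕ} (f : (Fin n → L) → L) (x : Fin n → C) : C :=
  sInf {c | ∃ k o : Fin n → C, (∀ i, IsClosedElt α (k i)) ∧ (∀ i, IsOpenElt α (o i)) ∧
    k ≤ x ∧ x ≤ o ∧
    c = sSup {d | ∃ a : Fin n → L, (∀ i, k i ≤ α (a i)) ∧ (∀ i, α (a i) ≤ o i) ∧ d = α (f a)}}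

/-- `C`, with the operations `F j` and the map `α`, is a canonical extension of the normal
lattice expansion `A`. -/
structure IsCanonicalExtensionNLE {J : Type v} {δ : J → DistType} (A : NLE δ L)
    (F : ∀ j : J, (Fin (δ j).arity → C) → C) (α : L → C) : Prop where
  lattice : IsCanonicalExtension α
  isNormalOp : ∀ j : J, IsNormalOp (δ j) (F j)
  extends_op : ∀ (j : J) (a : Fin (δ j).arity → L), F j (fun i => α (a i)) = α (A.op j a)
  eq_sigmaExt : ∀ j : J, (δ j).out = Sgn.one → F j = sigmaExt α (A.op j)
  eq_piExt : ∀ j : J, (δ j).out = Sgn.del → F j = piExt α (A.op j)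

end CanonicalExtension

/-- Two-sorted relational structures `(Z₁, Z_∂, I, (R_j)_{j ∈ J})` whose relation `R_j` has the
sort `σ j`, so `R_j ⊆ Z_{jₙ₊₁} × (Z_{j₁} × ⋯ × Z_{jₙ})`. Separation and smoothness are the
predicates `Frame.Separated` and `Frame.Smooth` below. -/
structure Frame {J : Type v} (σ : J → DistType) where
  Z : Sgn → Type u
  nonempty : ∀ s : Sgn, Nonempty (Z s)
  I : Z Sgn.one → Z Sgn.del → Prop
  R : ∀ j : J, Z (σ j).out → (∀ k : Fin (σ j).arity, Z ((σ j).inp k)) → Prop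

namespace Frame

variable {J : Type v} {σ : J → DistType} (F : Frame.{u, v} σ)

/-- The Galois relation (the complement of `I`), read from either sort. -/
def gal : ∀ s : Sgn, F.Z s → F.Z s.flip → Prop
  | Sgn.one => fun x y => ¬ F.I x y
  | Sgn.del => fun y x => ¬ F.I x y

/-- `U'` for a set `U` of points of sort `s`. -/
def up (s : Sgn) (U : Set (F.Z s)) : Set (F.Z s.flip) := {t | ∀ z ∈ U, F.gal s z t}

/-- `V'` for a set `V` of points of the sort other than `s`. -/
def down (s : Sgn) (V : Set (F.Z s.flip)) : Set (F.Z s) := {z | ∀ t ∈ V, F.gal s z t}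

/-- The closure `U''`. -/
def cl (s : Sgn) (U : Set (F.Z s)) : Set (F.Z s) := F.down s (F.up s U)

/-- Galois sets: stable sets for `s = 1`, co-stable sets for `s = ∂`. -/
def IsGalois (s : Sgn) (U : Set (F.Z s)) : Prop := F.cl s U = U

/-- The preorder `u ≼ w` iff `{u}' ⊆ {w}'` on each sort. -/
def le (s : Sgn) (z t : F.Z s) : Prop := F.up s {z} ⊆ F.up s {t}

/-- The closed element `Γ z = {t | z ≼ t}`. -/
def Gam (s : Sgn) (z : F.Z s) : Set (F.Z s) := {t | F.le s z t}

/-- The frame is separated. -/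
def Separated : Prop := ∀ (s : Sgn) (z t : F.Z s), F.le s z t → F.le s t z → z = t

/-- The Galois dual relation: `R'_j p = (R_j p)'`. -/
def Rdual (j : J) (t : F.Z (σ j).out.flip) (p : ∀ k, F.Z ((σ j).inp k)) : Prop :=
  t ∈ F.up (σ j).out {z | F.R j z p}

/-- All frame relations are smooth: every section of each Galois dual relation is a
Galois set. -/
def Smooth : Prop :=
  ∀ j : J,
    (∀ p : ∀ k, F.Z ((σ j).inp k), F.IsGalois (σ j).out.flip {t | F.Rdual j t p}) ∧
    (∀ (k : Fin (σ j).arity) (t : F.Z (σ j).out.flip) (p : ∀ k, F.Z ((σ j).inp k)),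
      F.IsGalois ((σ j).inp k) {z | F.Rdual j t (Function.update p k z)})

theorem subset_cl (s : Sgn) (U : Set (F.Z s)) : U ⊆ F.cl s U :=
  fun _ hz _ ht => ht _ hz

theorem down_up_down (s : Sgn) (V : Set (F.Z s.flip)) :
    F.cl s (F.down s V) = F.down s V :=
  Set.Subset.antisymm (fun _ hz t ht => hz t fun _ hx => hx t ht) (F.subset_cl s _)

theorem cl_cl (s : Sgn) (U : Set (F.Z s)) : F.cl s (F.cl s U) = F.cl s U :=
  F.down_up_down s _

theorem cl_mono (s : Sgn) {U V : Set (F.Z s)} (h : U ⊆ V) : F.cl s U ⊆ F.cl s V :=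
  fun _ hz t ht => hz t fun x hx => ht x (h hx)

theorem isGalois_Gam (s : Sgn) (z : F.Z s) : F.IsGalois s (F.Gam s z) := by
  have h : F.Gam s z = F.down s (F.up s {z}) := by
    ext t
    constructor
    · intro h r hr
      exact h hr t rfl
    · intro h r hr x hx
      rw [Set.mem_singleton_iff] at hx
      subst hx
      exact h r hr
  rw [h]
  exact F.down_up_down s _

/-- The Galois stable sets, `𝒢(Z₁)`. -/
def Stable : Type u := {U : Set (F.Z Sgn.one) // F.IsGalois Sgn.one U}

theorem isGalois_sInter {T : Set (Set (F.Z Sgn.one))} (h : ∀ U ∈ T, F.IsGalois Sgn.one U) :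
    F.IsGalois Sgn.one (⋂₀ T) := by
  refine Set.Subset.antisymm (fun z hz U hU => ?_) (F.subset_cl _ _)
  rw [← h U hU]
  exact F.cl_mono _ (Set.sInter_subset_of_mem hU) hz

theorem isGalois_inter {U V : Set (F.Z Sgn.one)} (hU : F.IsGalois Sgn.one U)
    (hV : F.IsGalois Sgn.one V) : F.IsGalois Sgn.one (U ∩ V) := by
  have h := F.isGalois_sInter (T := {U, V}) (by
    rintro W (rfl | rfl)
    · exact hU
    · exact hV)
  rwa [Set.sInter_pair] at h

theorem cl_subset {U V : Set (F.Z Sgn.one)} (hV : F.IsGalois Sgn.one V) (h : U ⊆ V) :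
    F.cl Sgn.one U ⊆ V := by
  rw [← hV]
  exact F.cl_mono _ h

/-- The complete lattice of stable sets: order is inclusion, meets are intersections, joins are
closures of unions. -/
instance : CompleteLattice F.Stable where
  le A B := A.1 ⊆ B.1
  le_refl A := Set.Subset.refl A.1
  le_trans _ _ _ h₁ h₂ := Set.Subset.trans h₁ h₂
  le_antisymm _ _ h₁ h₂ := Subtype.ext (Set.Subset.antisymm h₁ h₂)
  sup A B := ⟨F.cl Sgn.one (A.1 ∪ B.1), F.cl_cl _ _⟩
  inf A B := ⟨A.1 ∩ B.1, F.isGalois_inter A.2 B.2⟩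
  le_sup_left _ _ := Set.Subset.trans Set.subset_union_left (F.subset_cl _ _)
  le_sup_right _ _ := Set.Subset.trans Set.subset_union_right (F.subset_cl _ _)
  sup_le _ _ C h₁ h₂ := F.cl_subset C.2 (Set.union_subset h₁ h₂)
  inf_le_left _ _ := Set.inter_subset_left
  inf_le_right _ _ := Set.inter_subset_right
  le_inf _ _ _ h₁ h₂ := Set.subset_inter h₁ h₂
  sSup T := ⟨F.cl Sgn.one (⋃₀ (Subtype.val '' T)), F.cl_cl _ _⟩
  sInf T := ⟨⋂₀ (Subtype.val '' T), F.isGalois_sInter (by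
    rintro _ ⟨A, _, rfl⟩
    exact A.2)⟩
  isLUB_sSup T := by
    constructor
    · intro A hA
      exact Set.Subset.trans (Set.subset_sUnion_of_mem (Set.mem_image_of_mem Subtype.val hA)) (F.subset_cl _ _)
    · intro B hB
      refine F.cl_subset B.2 (Set.sUnion_subset ?_)
      rintro _ ⟨A, hA, rfl⟩
      exact hB hA
  isGLB_sInf T := by
    constructor
    · intro A hA
      exact Set.sInter_subset_of_mem (Set.mem_image_of_mem Subtype.val hA)
    · intro B hB
      refine Set.subset_sInter ?_
      rintro _ ⟨A, hA, rfl⟩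
      exact hB hA
  top := ⟨Set.univ, Set.Subset.antisymm (Set.subset_univ _) (F.subset_cl _ _)⟩
  bot := ⟨F.cl Sgn.one ∅, F.cl_cl _ _⟩
  le_top _ := Set.subset_univ _
  bot_le A := F.cl_subset A.2 (Set.empty_subset _)

/-- The sorted image operator generated by `R_j`. -/
def image (j : J) (W : ∀ k, Set (F.Z ((σ j).inp k))) : Set (F.Z (σ j).out) :=
  {z | ∃ p : ∀ k, F.Z ((σ j).inp k), F.R j z p ∧ ∀ k, p k ∈ W k}

/-- A stable set `A` as an argument of sort `s`: `A` for `s = 1` and `A'` for `s = ∂`. -/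
def toSort (A : F.Stable) : ∀ s : Sgn, Set (F.Z s)
  | Sgn.one => A.1
  | Sgn.del => F.up Sgn.one A.1

/-- The stable set given by the closure of `V`, a set of sort `s`: `V''` for `s = 1` and
`(V'')'` for `s = ∂`. -/
def ofSort : ∀ s : Sgn, Set (F.Z s) → F.Stable
  | Sgn.one => fun V => ⟨F.cl Sgn.one V, F.cl_cl Sgn.one V⟩
  | Sgn.del => fun V => ⟨F.down Sgn.one (F.cl Sgn.del V), F.down_up_down Sgn.one (F.cl Sgn.del V)⟩

/-- The operation of the full complex algebra of the frame that is generated by `R_j`: the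
closure of the sorted image operator composed with the Galois connection. The full complex algebra is the
complete lattice `F.Stable` with these operations. -/
def complexOp (j : J) (A : Fin (σ j).arity → F.Stable) : F.Stable :=
  F.ofSort (σ j).out (F.image j (fun k => F.toSort (A k) ((σ j).inp k)))

/-- The closed element `Γ x` as a member of `𝒢(Z₁)`. -/
def GamS (x : F.Z Sgn.one) : F.Stable := ⟨F.Gam Sgn.one x, F.isGalois_Gam _ _⟩

end Frame

section Refined

variable (F : Frame.{u, 0} modalType)

/-- The operator `□` of the full complex algebra on stable sets. -/
def boxOp (A : F.Stable) : F.Stable := F.complexOp ModalIdx.box (fun _ : Fin 1 => A)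

/-- `R'_□ ⊆ Z₁ × Z_∂`, the Galois dual of `R_□`. -/
def boxDual (x : F.Z Sgn.one) (y : F.Z Sgn.del) : Prop :=
  F.Rdual ModalIdx.box x (fun _ => y)

/-- The section `x R''_□ = (x R'_□)'` of the double dual relation `R''_□ ⊆ Z₁ × Z₁`. -/
def boxDoubleDual (x : F.Z Sgn.one) : Set (F.Z Sgn.one) :=
  F.down Sgn.one {y : F.Z Sgn.del | boxDual F x y}

/-- Refined frames. -/
structure IsRefinedFrame : Prop where
  /-- (F1) the frame is separated -/
  separated : F.Separated
  /-- (F2) each relation is increasing in the first place -/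
  increasing : ∀ (j : ModalIdx) (z t : F.Z (modalType j).out)
    (p : ∀ k, F.Z ((modalType j).inp k)), F.le _ z t → F.R j z p → F.R j t p
  /-- (F2) each relation is decreasing in every other place -/
  decreasing : ∀ (j : ModalIdx) (z : F.Z (modalType j).out)
    (p : ∀ k, F.Z ((modalType j).inp k)) (k : Fin (modalType j).arity)
    (t : F.Z ((modalType j).inp k)),
    F.le _ t (p k) → F.R j z p → F.R j z (Function.update p k t)
  /-- (F3) each section `R_j p` is a closed element -/
  closed_section : ∀ (j : ModalIdx) (p : ∀ k, F.Z ((modalType j).inp k)),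
    ∃ t : F.Z (modalType j).out, {z | F.R j z p} = F.Gam _ t
  /-- (F4) each relation is smooth -/
  smooth : F.Smooth
  /-- (F5) each section `{z | z R''_□ ⊆ Γ x}` is a closed element -/
  box_closed : ∀ x : F.Z Sgn.one, ∃ t : F.Z Sgn.one,
    {z | boxDoubleDual F z ⊆ F.Gam Sgn.one x} = F.Gam Sgn.one t
  /-- (F6) restricted join-distributivity of `□` -/
  box_iSup : ∀ A : F.Stable,
    boxOp F (⨆ x ∈ A.1, F.GamS x) ≤ ⨆ x ∈ A.1, boxOp F (F.GamS x)

end Refined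

section Dual

variable {L : Type u} [Lattice L] [BoundedOrder L]

/-- The points of the dual frame: filters for the sort `1`, ideals for the sort `∂`. -/
def dualPoint (L : Type u) [Lattice L] : Sgn → Type u
  | Sgn.one => Order.PFilter L
  | Sgn.del => Order.Ideal L

/-- `a ∈ z` for a filter or ideal `z`. -/
def dualMem (a : L) : ∀ s : Sgn, dualPoint L s → Prop
  | Sgn.one => fun x : Order.PFilter L => a ∈ x
  | Sgn.del => fun y : Order.Ideal L => a ∈ y

/-- The dual frame of a normal lattice expansion. -/
def dualFrame {J : Type v} {δ : J → DistType} (A : NLE δ L) : Frame.{u, v} δ where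
  Z := dualPoint L
  nonempty s := match s with
    | Sgn.one => ⟨(Order.PFilter.principal ⊤ : Order.PFilter L)⟩
    | Sgn.del => ⟨(Order.Ideal.principal ⊥ : Order.Ideal L)⟩
  I := fun (x : Order.PFilter L) (y : Order.Ideal L) => (x : Set L) ∩ (y : Set L) = ∅
  R := fun j z p => ∀ a : Fin (δ j).arity → L,
    (∀ k, dualMem (a k) ((δ j).inp k) (p k)) → dualMem (A.op j a) (δ j).out z

theorem isGalois_filtersContaining {J : Type v} {δ : J → DistType} (A : NLE δ L) (a : L) :
    (dualFrame A).IsGalois Sgn.one {x : Order.PFilter L | a ∈ x} := by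
  refine Set.Subset.antisymm (fun (x : Order.PFilter L) hx => ?_) (Frame.subset_cl _ _ _)
  have h : ¬ ((x : Set L) ∩ ((Order.Ideal.principal a : Order.Ideal L) : Set L) = ∅) := by
    refine hx (Order.Ideal.principal a : Order.Ideal L) ?_
    intro (z : Order.PFilter L) (hz : a ∈ z)
    change ¬ ((z : Set L) ∩ ((Order.Ideal.principal a : Order.Ideal L) : Set L) = ∅)
    rw [← Ne, ← Set.nonempty_iff_ne_empty]
    exact ⟨a, hz, Order.Ideal.mem_principal_self⟩
  rw [← Ne, ← Set.nonempty_iff_ne_empty] at h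
  obtain ⟨b, hb, hba⟩ := h
  exact x.mem_of_le (Order.Ideal.mem_principal.1 hba) hb

/-- The representation map: `a` goes to the set of filters containing `a`. -/
def zeta {J : Type v} {δ : J → DistType} (A : NLE δ L) (a : L) : (dualFrame A).Stable :=
  ⟨{x : Order.PFilter L | a ∈ x}, isGalois_filtersContaining A a⟩

end Dual

/-! Ideals of `L` are the filters of `Lᵒᵖ`, so with signed joins and orders both sorts are handled
by one argument. A filter and an ideal are Galois related exactly when they share an element, hence
`≼` is inclusion and separation is immediate. The values of `f_j` on a tuple of points `p` generate
a point `w` of the output sort, and `R_j p = Γ w`. Therefore `t R'_j p` holds iff some `a` in `p`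
has its value in `t` (`dualFrame_Rdual`).

Smoothness is where normality enters: with `t` and all arguments but one fixed, the `c` that send a
value into `t` form a point of the opposite sort, and the section is the polar of that point.
Smoothness in turn lets a closure in an argument be dropped below the polar of the image, so the
complex operations inherit distribution from unions.

For compactness, finite meets from one side generate a filter, finite joins from the other an ideal;
the inequality forces a common element. For the extensions, a complex operation is a join of meets
(or meet of joins) of values over tuples of points, and these tuples are mutually cofinal with the
pairs of closed and open bounds in the definition of `f^σ` and `f^π`. In the modal case, taking
preimages of filters under `□` describes the operation on stable sets pointwise. -/

section SignedOrder

/-! ### The order of `L` and of `Lᵒᵖ`, treated uniformly. -/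

variable {L : Type u} [Lattice L]

/-- The order of `L¹ = L` or of `L^∂ = Lᵒᵖ`, as a relation on `L`. -/
def signedLe : Sgn → L → L → Prop
  | Sgn.one => fun a b => a ≤ b
  | Sgn.del => fun a b => b ≤ a

theorem signedSup_eq_right_iff {s : Sgn} {a b : L} : signedSup s a b = b ↔ signedLe s a b := by
  cases s
  · exact sup_eq_right
  · exact inf_eq_right

theorem signedLe_refl (s : Sgn) (a : L) : signedLe s a a := by
  cases s <;> exact le_refl a

theorem signedLe.trans {s : Sgn} {a b c : L} (h₁ : signedLe s a b) (h₂ : signedLe s b c) :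
    signedLe s a c := by
  cases s
  · exact le_trans h₁ h₂
  · exact le_trans h₂ h₁

theorem signedLe_flip {s : Sgn} {a b : L} : signedLe s.flip a b ↔ signedLe s b a := by
  cases s <;> exact Iff.rfl

/-- The meet of `L^s` is the join of the opposite lattice, so `signedSup s.flip` and `signedBot
s.flip` serve as meet and top for `signedLe s`. -/
theorem signedInf_le_left (s : Sgn) (a b : L) : signedLe s (signedSup s.flip a b) a := by
  cases s
  · exact inf_le_left
  · exact le_sup_left (α := L)

theorem signedInf_le_right (s : Sgn) (a b : L) : signedLe s (signedSup s.flip a b) b := by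
  cases s
  · exact inf_le_right
  · exact le_sup_right (α := L)

theorem signedLe_signedInf {s : Sgn} {a b c : L} (h₁ : signedLe s a b) (h₂ : signedLe s a c) :
    signedLe s a (signedSup s.flip b c) := by
  cases s
  · exact le_inf h₁ h₂
  · exact sup_le (α := L) h₁ h₂

theorem signedLe_signedTop [BoundedOrder L] (s : Sgn) (a : L) :
    signedLe s a (signedBot s.flip) := by
  cases s
  · exact le_top
  · exact bot_le (α := L)

/-- Binary additivity makes `f` monotone in a single place. The tuple `a` is changed into `b` one
coordinate at a time, by induction on a finite set outside which they already agree. -/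
theorem IsNormalOp.mono [BoundedOrder L] {δ : DistType} {f : (Fin δ.arity → L) → L}
    (hf : IsNormalOp δ f) {a b : Fin δ.arity → L}
    (h : ∀ k, signedLe (δ.inp k) (a k) (b k)) : signedLe δ.out (f a) (f b) := by
  classical
  have key : ∀ (S : Finset (Fin δ.arity)) (a : Fin δ.arity → L),
      (∀ k, signedLe (δ.inp k) (a k) (b k)) → (∀ k, k ∉ S → a k = b k) →
      signedLe δ.out (f a) (f b) := by
    intro S
    induction S using Finset.induction_on with
    | empty =>
      intro a _ h
      have : a = b := funext fun k => h k (Finset.notMem_empty k)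
      rw [this]
      exact signedLe_refl _ _
    | insert k S _ ih =>
      intro a ha hab
      have step : signedLe δ.out (f a) (f (Function.update a k (b k))) := by
        rw [← signedSup_eq_right_iff]
        have := hf.additive k a (a k) (b k)
        rw [signedSup_eq_right_iff.2 (ha k), Function.update_eq_self] at this
        exact this.symm
      refine step.trans (ih _ (fun i => ?_) fun i hi => ?_)
      · rcases eq_or_ne i k with rfl | hik
        · rw [Function.update_self]
          exact signedLe_refl _ _
        · rw [Function.update_of_ne hik]
          exact ha i
      · rcases eq_or_ne i k with rfl | hik
        · rw [Function.update_self]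
        · rw [Function.update_of_ne hik]
          exact hab i (by simp [hik, hi])
  exact key Finset.univ a h fun k hk => absurd (Finset.mem_univ k) hk

end SignedOrder

/-! ### Filters and ideals as filters of a signed lattice. -/

section DualPoints

variable {L : Type u} [Lattice L]

theorem dualMem.of_le {s : Sgn} {z : dualPoint L s} {a b : L} (ha : dualMem a s z)
    (h : signedLe s a b) : dualMem b s z := by
  cases s
  · exact Order.PFilter.mem_of_le (F := (z : Order.PFilter L)) h ha
  · exact (z : Order.Ideal L).lower h ha

theorem dualMem.signedInf {s : Sgn} {z : dualPoint L s} {a b : L} (ha : dualMem a s z)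
    (hb : dualMem b s z) : dualMem (signedSup s.flip a b) s z := by
  cases s
  · exact Order.PFilter.inf_mem (F := (z : Order.PFilter L)) ha hb
  · exact Order.Ideal.sup_mem (s := (z : Order.Ideal L)) ha hb

theorem dualMem_signedTop [BoundedOrder L] {s : Sgn} (z : dualPoint L s) :
    dualMem (signedBot s.flip) s z := by
  cases s
  · exact Order.PFilter.top_mem (F := (z : Order.PFilter L))
  · exact Order.Ideal.bot_mem (z : Order.Ideal L)

theorem dualPoint_ext {s : Sgn} {z t : dualPoint L s} (h : ∀ a, dualMem a s z ↔ dualMem a s t) :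
    z = t := by
  cases s
  · exact SetLike.ext (A := Order.PFilter L) h
  · exact SetLike.ext (A := Order.Ideal L) h

/-- The one device for building points: nonemptiness, closure under signed meets and upward closure
suffice in both sorts. Later arguments use only the resulting membership criterion. -/
theorem exists_dualPoint [BoundedOrder L] (s : Sgn) (S : Set L) (htop : signedBot s.flip ∈ S)
    (hinf : ∀ a ∈ S, ∀ b ∈ S, signedSup s.flip a b ∈ S)
    (hup : ∀ a ∈ S, ∀ b, signedLe s a b → b ∈ S) :
    ∃ z : dualPoint L s, ∀ a, dualMem a s z ↔ a ∈ S := by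
  cases s
  · have h : Order.IsPFilter S := Order.IsPFilter.of_def ⟨_, htop⟩
      (fun a ha b hb => ⟨_, hinf a ha b hb, inf_le_left, inf_le_right⟩)
      fun {a b} hab ha => hup a ha b hab
    exact ⟨h.toPFilter, fun a => Iff.rfl⟩
  · have h : Order.IsIdeal S :=
      ⟨fun a b hab ha => hup a ha b hab, ⟨_, htop⟩,
        fun a ha b hb => ⟨_, hinf a ha b hb, le_sup_left (α := L), le_sup_right (α := L)⟩⟩
    exact ⟨h.toIdeal, fun a => Iff.rfl⟩

theorem exists_dualPoint_principal [BoundedOrder L] (s : Sgn) (a : L) :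
    ∃ z : dualPoint L s, ∀ b, dualMem b s z ↔ signedLe s a b :=
  exists_dualPoint s {b | signedLe s a b} (signedLe_signedTop s a)
    (fun _ hb _ hc => signedLe_signedInf hb hc) fun _ hb _ hc => signedLe.trans hb hc

end DualPoints

/-! ### Smooth frames: complex operations are normal. -/

namespace Frame

variable {J : Type v} {σ : J → DistType} (F : Frame.{u, v} σ)

theorem up_cl (s : Sgn) (U : Set (F.Z s)) : F.up s (F.cl s U) = F.up s U :=
  Set.Subset.antisymm (fun _ ht _ hz => ht _ (F.subset_cl s U hz)) fun _ ht _ hz => hz _ ht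

theorem IsGalois.cl_subset {F : Frame.{u, v} σ} {s : Sgn} {U V : Set (F.Z s)}
    (hV : F.IsGalois s V) (h : U ⊆ V) : F.cl s U ⊆ V := by
  rw [← hV]
  exact F.cl_mono s h

/-- Only the polar of a set enters its closure, so operations can be compared through polars of
images. -/
theorem ofSort_congr {s : Sgn} {U V : Set (F.Z s)} (h : F.up s U = F.up s V) :
    F.ofSort s U = F.ofSort s V := by
  cases s
  · exact Subtype.ext (congrArg (F.down Sgn.one) h)
  · exact Subtype.ext (congrArg (fun W => F.down Sgn.one (F.down Sgn.del W)) h)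

/-- For the sort `∂` this is `(A ∩ B)' = (A' ∪ B')''`, which holds because `A = A''` and `B = B''`.
-/
theorem toSort_signedSup (s : Sgn) (A B : F.Stable) :
    F.toSort (signedSup s A B) s = F.cl s (F.toSort A s ∪ F.toSort B s) := by
  cases s
  · rfl
  · change F.up Sgn.one (A.1 ∩ B.1) =
      F.up Sgn.one (F.down Sgn.one (F.up Sgn.one A.1 ∪ F.up Sgn.one B.1))
    congr 1
    conv_lhs => rw [← A.2, ← B.2]
    ext x
    exact ⟨fun h t ht => ht.elim (h.1 t) (h.2 t),
      fun h => ⟨fun t ht => h t (Or.inl ht), fun t ht => h t (Or.inr ht)⟩⟩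

theorem toSort_signedBot (s : Sgn) :
    F.toSort (signedBot s) s = F.cl s ∅ := by
  cases s
  · rfl
  · change F.up Sgn.one Set.univ = F.up Sgn.one (F.down Sgn.one ∅)
    congr 1
    ext x
    exact ⟨fun _ t ht => ht.elim, fun _ => trivial⟩

theorem isGalois_up (s : Sgn) (U : Set (F.Z s)) : F.IsGalois s.flip (F.up s U) := by
  cases s <;> exact F.up_cl _ U

theorem up_union (s : Sgn) (U V : Set (F.Z s)) : F.up s (U ∪ V) = F.up s U ∩ F.up s V := by
  ext t
  exact ⟨fun h => ⟨fun z hz => h z (Or.inl hz), fun z hz => h z (Or.inr hz)⟩,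
    fun h z hz => hz.elim (h.1 z) (h.2 z)⟩

theorem ofSort_del_val (V : Set (F.Z Sgn.del)) :
    (F.ofSort Sgn.del V).1 = F.down Sgn.one V :=
  Set.Subset.antisymm (fun _ hx _ ht => hx _ (F.subset_cl Sgn.del V ht))
    fun _ hx _ ht => ht _ hx

theorem ofSort_union (s : Sgn) (U V : Set (F.Z s)) :
    F.ofSort s (U ∪ V) = signedSup s (F.ofSort s U) (F.ofSort s V) := by
  cases s
  · refine Subtype.ext (congrArg (F.down Sgn.one) ?_)
    change F.up Sgn.one _ = F.up Sgn.one (F.cl Sgn.one U ∪ F.cl Sgn.one V)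
    rw [up_union, up_union, up_cl, up_cl]
  · refine Subtype.ext ?_
    change _ = (F.ofSort Sgn.del U).1 ∩ (F.ofSort Sgn.del V).1
    rw [ofSort_del_val, ofSort_del_val, ofSort_del_val]
    exact F.up_union Sgn.del U V

theorem ofSort_empty (s : Sgn) : F.ofSort s ∅ = signedBot s := by
  cases s
  · rfl
  · refine Subtype.ext ?_
    rw [ofSort_del_val]
    exact Set.eq_univ_of_forall fun x t ht => ht.elim

/-- The sort is fixed by an equation because it will be `(δ j).out`, which is not literally `1`. -/
theorem ofSort_eq_sSup {s : Sgn} (hs : s = Sgn.one) {ι : Type*} (P : Set ι)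
    (V : ι → Set (F.Z s)) :
    F.ofSort s {z | ∃ i ∈ P, z ∈ V i} = sSup ((fun i => F.ofSort s (V i)) '' P) := by
  subst hs
  refine le_antisymm ?_ (sSup_le ?_)
  · refine F.cl_subset (Subtype.property _) ?_
    rintro z ⟨i, hi, hz⟩
    have h : F.ofSort Sgn.one (V i) ≤ sSup ((fun i => F.ofSort Sgn.one (V i)) '' P) :=
      le_sSup ⟨i, hi, rfl⟩
    exact h (F.subset_cl _ _ hz)
  · rintro _ ⟨i, hi, rfl⟩
    exact F.cl_mono _ fun z hz => ⟨i, hi, hz⟩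

theorem mem_sInf {T : Set F.Stable} {x : F.Z Sgn.one} : x ∈ (sInf T).1 ↔ ∀ A ∈ T, x ∈ A.1 :=
  ⟨fun h A hA => h A.1 ⟨A, hA, rfl⟩, by
    rintro h _ ⟨A, hA, rfl⟩
    exact h A hA⟩

theorem ofSort_eq_sInf {s : Sgn} (hs : s = Sgn.del) {ι : Type*} (P : Set ι)
    (V : ι → Set (F.Z s)) :
    F.ofSort s {z | ∃ i ∈ P, z ∈ V i} = sInf ((fun i => F.ofSort s (V i)) '' P) := by
  subst hs
  refine Subtype.ext (Set.ext fun x => ?_)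
  rw [mem_sInf, Set.forall_mem_image, ofSort_del_val]
  constructor
  · intro h i hi
    rw [ofSort_del_val]
    exact fun t ht => h t ⟨i, hi, ht⟩
  · rintro h t ⟨i, hi, ht⟩
    have := h hi
    rw [ofSort_del_val] at this
    exact this t ht

theorem mem_up_image {j : J} {W : ∀ k, Set (F.Z ((σ j).inp k))} {t : F.Z (σ j).out.flip} :
    t ∈ F.up _ (F.image j W) ↔ ∀ p : ∀ k, F.Z ((σ j).inp k), (∀ k, p k ∈ W k) → F.Rdual j t p :=
  ⟨fun h p hp z hz => h z ⟨p, hz, hp⟩, fun h z ⟨p, hz, hp⟩ => h p hp z hz⟩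

theorem mem_update_iff {j : J} {W : ∀ k, Set (F.Z ((σ j).inp k))} {k : Fin (σ j).arity}
    {U : Set (F.Z ((σ j).inp k))} {p : ∀ k, F.Z ((σ j).inp k)} :
    (∀ i, p i ∈ Function.update W k U i) ↔ p k ∈ U ∧ ∀ i, i ≠ k → p i ∈ W i := by
  constructor
  · intro h
    refine ⟨by simpa using h k, fun i hi => by simpa [hi] using h i⟩
  · rintro ⟨h₁, h₂⟩ i
    rcases eq_or_ne i k with rfl | hi
    · simpa using h₁
    · simpa [hi] using h₂ i hi

/-- For fixed `t` and fixed remaining arguments, the admissible points in place `k` form a section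
of `R'_j`. By smoothness that section is a Galois set, so it contains `U''` as soon as it contains
`U`. -/
theorem up_image_update_cl (hF : F.Smooth) (j : J) (W : ∀ k, Set (F.Z ((σ j).inp k)))
    (k : Fin (σ j).arity) (U : Set (F.Z ((σ j).inp k))) :
    F.up _ (F.image j (Function.update W k (F.cl _ U))) =
      F.up _ (F.image j (Function.update W k U)) := by
  ext t
  rw [mem_up_image, mem_up_image]
  constructor
  · intro h p hp
    rw [mem_update_iff] at hp
    exact h p (F.mem_update_iff.2 ⟨F.subset_cl _ _ hp.1, hp.2⟩)
  · intro h p hp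
    rw [mem_update_iff] at hp
    have : F.cl _ U ⊆ {z | F.Rdual j t (Function.update p k z)} := by
      refine ((hF j).2 k t p).cl_subset fun z hz => h _ (F.mem_update_iff.2 ⟨?_, fun i hi => ?_⟩)
      · simpa using hz
      · simpa [hi] using hp.2 i hi
    simpa using this hp.1

theorem toSort_update (j : J) (A : Fin (σ j).arity → F.Stable) (k : Fin (σ j).arity)
    (B : F.Stable) :
    (fun i => F.toSort (Function.update A k B i) ((σ j).inp i)) =
      Function.update (fun i => F.toSort (A i) ((σ j).inp i)) k (F.toSort B ((σ j).inp k)) := by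
  funext i
  rcases eq_or_ne i k with rfl | hi
  · simp
  · simp [hi]

theorem image_update_union (j : J) (W : ∀ k, Set (F.Z ((σ j).inp k))) (k : Fin (σ j).arity)
    (U V : Set (F.Z ((σ j).inp k))) :
    F.image j (Function.update W k (U ∪ V)) =
      F.image j (Function.update W k U) ∪ F.image j (Function.update W k V) := by
  ext z
  simp only [image, mem_update_iff, Set.mem_union, Set.mem_ofPred_eq, ← exists_or]
  exact exists_congr fun p => by tauto

theorem image_update_empty (j : J) (W : ∀ k, Set (F.Z ((σ j).inp k))) (k : Fin (σ j).arity) :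
    F.image j (Function.update W k ∅) = ∅ := by
  refine Set.eq_empty_of_forall_notMem ?_
  rintro z ⟨p, -, hp⟩
  exact (F.mem_update_iff.1 hp).1

theorem isNormalOp_complexOp (hF : F.Smooth) (j : J) : IsNormalOp (σ j) (F.complexOp j) where
  additive k A B C := by
    simp only [complexOp, toSort_update, toSort_signedSup]
    rw [F.ofSort_congr (F.up_image_update_cl hF j _ k _), image_update_union, ofSort_union]
  normal k A := by
    simp only [complexOp, toSort_update, toSort_signedBot]
    rw [F.ofSort_congr (F.up_image_update_cl hF j _ k _), image_update_empty, ofSort_empty]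

theorem le_sSup_Gam (A : F.Stable) : A ≤ ⨆ x ∈ A.1, F.GamS x := by
  intro x hx
  have h : F.GamS x ≤ ⨆ x ∈ A.1, F.GamS x := le_iSup₂ (f := fun x _ => F.GamS x) x hx
  exact h (Set.Subset.refl (F.up Sgn.one {x}))

theorem Gam_subset {A : F.Stable} {x : F.Z Sgn.one} (hx : x ∈ A.1) : F.GamS x ≤ A := by
  intro t ht
  rw [← A.2]
  intro y hy
  refine ht (fun z hz => ?_) t rfl
  rw [Set.mem_singleton_iff.1 hz]
  exact hy x hx

theorem iSup_Gam (A : F.Stable) : ⨆ x ∈ A.1, F.GamS x = A :=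
  le_antisymm (iSup₂_le fun _ hx => F.Gam_subset hx) (F.le_sSup_Gam A)

end Frame

/-! ### The dual frame: separation, closed sections, smoothness. -/

section DualFrame

variable {J : Type v} {δ : J → DistType} {L : Type u} [Lattice L] [BoundedOrder L] (A : NLE δ L)

theorem dualFrame_gal {s : Sgn} {z : (dualFrame A).Z s} {t : (dualFrame A).Z s.flip} :
    (dualFrame A).gal s z t ↔ ∃ a : L, dualMem a s z ∧ dualMem a s.flip t := by
  have key : ∀ (x : Order.PFilter L) (y : Order.Ideal L),
      ¬ ((x : Set L) ∩ (y : Set L) = ∅) ↔ ∃ a : L, a ∈ x ∧ a ∈ y := fun x y => by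
    rw [← Ne, ← Set.nonempty_iff_ne_empty]
    rfl
  cases s
  · exact key z t
  · exact (key t z).trans (exists_congr fun _ => and_comm)

theorem dualFrame_le {s : Sgn} {z t : (dualFrame A).Z s} :
    (dualFrame A).le s z t ↔ ∀ a : L, dualMem a s z → dualMem a s t := by
  constructor
  · intro h a ha
    -- The principal point of the opposite sort tests membership: any point Galois related to `y`
    -- contains `a`.
    obtain ⟨y, hy⟩ := exists_dualPoint_principal s.flip a
    have hzy : y ∈ (dualFrame A).up s {z} := by
      rintro _ rfl
      exact (dualFrame_gal A).2 ⟨a, ha, (hy a).2 (signedLe_refl _ _)⟩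
    obtain ⟨b, hb, hby⟩ := (dualFrame_gal A).1 (h hzy t rfl)
    exact dualMem.of_le hb (signedLe_flip.1 ((hy b).1 hby))
  · rintro h y hy _ rfl
    obtain ⟨a, ha, hay⟩ := (dualFrame_gal A).1 (hy z rfl)
    exact (dualFrame_gal A).2 ⟨a, h a ha, hay⟩

theorem dualFrame_separated : (dualFrame A).Separated := fun _ _ _ h₁ h₂ =>
  dualPoint_ext fun a => ⟨(dualFrame_le A).1 h₁ a, (dualFrame_le A).1 h₂ a⟩

/-- Two values lie above the value at the coordinatewise meet of their tuples, which still belongs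
to `p`; so the values already generate a point by upward closure alone. The tuple of tops gives
nonemptiness. -/
theorem dualFrame_exists_section (j : J) (p : ∀ k, (dualFrame A).Z ((δ j).inp k)) :
    ∃ w : (dualFrame A).Z (δ j).out, ∀ b : L, dualMem b (δ j).out w ↔
      ∃ a : Fin (δ j).arity → L, (∀ k, dualMem (a k) ((δ j).inp k) (p k)) ∧
        signedLe (δ j).out (A.op j a) b := by
  refine exists_dualPoint (δ j).out {b | ∃ a : Fin (δ j).arity → L,
    (∀ k, dualMem (a k) ((δ j).inp k) (p k)) ∧ signedLe (δ j).out (A.op j a) b} ?_ ?_ ?_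
  · exact ⟨fun k => signedBot ((δ j).inp k).flip, fun k => dualMem_signedTop _,
      signedLe_signedTop _ _⟩
  · rintro b ⟨a, ha, hab⟩ c ⟨a', ha', hac⟩
    refine ⟨fun k => signedSup ((δ j).inp k).flip (a k) (a' k),
      fun k => (ha k).signedInf (ha' k), signedLe_signedInf ?_ ?_⟩
    · exact ((A.isNormalOp j).mono fun k => signedInf_le_left _ _ _).trans hab
    · exact ((A.isNormalOp j).mono fun k => signedInf_le_right _ _ _).trans hac
  · rintro b ⟨a, ha, hab⟩ c hbc
    exact ⟨a, ha, hab.trans hbc⟩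

theorem dualFrame_closed_section (j : J) (p : ∀ k, (dualFrame A).Z ((δ j).inp k)) :
    ∃ t : (dualFrame A).Z (δ j).out, {z | (dualFrame A).R j z p} = (dualFrame A).Gam _ t := by
  obtain ⟨w, hw⟩ := dualFrame_exists_section A j p
  refine ⟨w, Set.ext fun z => ⟨fun hz => (dualFrame_le A).2 fun b hb => ?_, fun hz a ha => ?_⟩⟩
  · obtain ⟨a, ha, hab⟩ := (hw b).1 hb
    exact dualMem.of_le (hz a ha) hab
  · exact (dualFrame_le A).1 hz _ ((hw _).2 ⟨a, ha, signedLe_refl _ _⟩)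

/-- It is enough to test `t` against the least point of `R_j p`, the one generated by the values. -/
theorem dualFrame_Rdual {j : J} {t : (dualFrame A).Z (δ j).out.flip}
    {p : ∀ k, (dualFrame A).Z ((δ j).inp k)} :
    (dualFrame A).Rdual j t p ↔ ∃ a : Fin (δ j).arity → L,
      (∀ k, dualMem (a k) ((δ j).inp k) (p k)) ∧ dualMem (A.op j a) (δ j).out.flip t := by
  constructor
  · intro h
    obtain ⟨w, hw⟩ := dualFrame_exists_section A j p
    obtain ⟨b, hb, hbt⟩ := (dualFrame_gal A).1
      (h w fun a ha => (hw _).2 ⟨a, ha, signedLe_refl _ _⟩)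
    obtain ⟨a, ha, hab⟩ := (hw b).1 hb
    exact ⟨a, ha, hbt.of_le (signedLe_flip.2 hab)⟩
  · rintro ⟨a, ha, hat⟩ z hz
    exact (dualFrame_gal A).2 ⟨_, hz a ha, hat⟩

theorem dualFrame_isGalois_of_gal {s : Sgn} (y : (dualFrame A).Z s.flip) :
    (dualFrame A).IsGalois s {z | (dualFrame A).gal s z y} := by
  have h : {z | (dualFrame A).gal s z y} = (dualFrame A).down s {y} := by
    ext z
    exact ⟨fun hz t ht => by rw [Set.mem_singleton_iff.1 ht]; exact hz, fun hz => hz y rfl⟩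
  rw [h]
  exact Frame.down_up_down _ _ _

theorem dualFrame_isGalois_Rdual (j : J) (p : ∀ k, (dualFrame A).Z ((δ j).inp k)) :
    (dualFrame A).IsGalois (δ j).out.flip {t | (dualFrame A).Rdual j t p} :=
  (dualFrame A).isGalois_up _ _

theorem dualFrame_smooth : (dualFrame A).Smooth := by
  refine fun j => ⟨dualFrame_isGalois_Rdual A j, fun k t p => ?_⟩
  -- The section will be the polar of `y`, the point of all `c` which in place `k`, with the other
  -- entries taken from `p`, give a value in `t`.
  have hy : ∃ y : dualPoint L ((δ j).inp k).flip, ∀ c, dualMem c ((δ j).inp k).flip y ↔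
      c ∈ {c : L | ∃ a : Fin (δ j).arity → L, (∀ i, i ≠ k → dualMem (a i) ((δ j).inp i) (p i)) ∧
        dualMem (A.op j (Function.update a k c)) (δ j).out.flip t} := by
    have hflip : ∀ s : Sgn, s.flip.flip = s := by
      intro s
      cases s <;> rfl
    refine exists_dualPoint _ _ ?_ ?_ ?_
    · refine ⟨fun i => signedBot ((δ j).inp i).flip, fun i _ => dualMem_signedTop _, ?_⟩
      -- Normality puts the empty join into `y`: its value is the bottom of `L^{out}`, which every
      -- point of the opposite sort contains.
      rw [hflip, (A.isNormalOp j).normal]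
      have := dualMem_signedTop t
      rwa [hflip] at this
    · rintro c ⟨a, ha, hac⟩ d ⟨a', ha', had⟩
      refine ⟨fun i => signedSup ((δ j).inp i).flip (a i) (a' i),
        fun i hi => (ha i hi).signedInf (ha' i hi), ?_⟩
      -- Additivity splits the value at the join of `c` and `d`. Meeting the other entries only
      -- lowers both values in `L^{out}`, so they stay in `t`, as does their join.
      rw [hflip, (A.isNormalOp j).additive]
      have := dualMem.signedInf
        (dualMem.of_le hac (signedLe_flip.2 ((A.isNormalOp j).mono
          (a := Function.update (fun i => signedSup ((δ j).inp i).flip (a i) (a' i)) k c)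
          (b := Function.update a k c) fun i => ?_)))
        (dualMem.of_le had (signedLe_flip.2 ((A.isNormalOp j).mono
          (a := Function.update (fun i => signedSup ((δ j).inp i).flip (a i) (a' i)) k d)
          (b := Function.update a' k d) fun i => ?_)))
      · rwa [hflip] at this
      · rcases eq_or_ne i k with rfl | hi
        · simpa using signedLe_refl _ _
        · simpa [hi] using signedInf_le_left _ _ _
      · rcases eq_or_ne i k with rfl | hi
        · simpa using signedLe_refl _ _
        · simpa [hi] using signedInf_le_right _ _ _
    · rintro c ⟨a, ha, hac⟩ d hcd
      refine ⟨a, ha, dualMem.of_le hac (signedLe_flip.2 ((A.isNormalOp j).mono fun i => ?_))⟩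
      rcases eq_or_ne i k with rfl | hi
      · simpa using signedLe_flip.1 hcd
      · simpa [hi] using signedLe_refl _ _
  obtain ⟨y, hy⟩ := hy
  have h : {z | (dualFrame A).Rdual j t (Function.update p k z)} =
      {z | (dualFrame A).gal _ z y} := by
    ext z
    refine (dualFrame_Rdual A).trans (Iff.trans ?_ (dualFrame_gal A).symm)
    constructor
    · rintro ⟨a, ha, hat⟩
      refine ⟨a k, by simpa using ha k, (hy _).2 ⟨a, fun i hi => by simpa [hi] using ha i, ?_⟩⟩
      rwa [Function.update_eq_self]
    · rintro ⟨c, hcz, hcy⟩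
      obtain ⟨a, ha, hac⟩ := (hy c).1 hcy
      refine ⟨Function.update a k c, fun i => ?_, hac⟩
      rcases eq_or_ne i k with rfl | hi
      · simpa using hcz
      · simpa [hi] using ha i hi
  rw [h]
  exact dualFrame_isGalois_of_gal A y

/-! ### The representation as a canonical extension of the lattice. -/

theorem mem_up_zeta {a : L} {y : (dualFrame A).Z Sgn.del} :
    y ∈ (dualFrame A).up Sgn.one (zeta A a).1 ↔ dualMem a Sgn.del y := by
  constructor
  · intro h
    obtain ⟨x, hx⟩ := exists_dualPoint_principal Sgn.one a
    obtain ⟨b, hb, hby⟩ := (dualFrame_gal A).1 (h x ((hx a).2 (le_refl a)))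
    exact dualMem.of_le hby ((hx b).1 hb)
  · exact fun h x hx => (dualFrame_gal A).2 ⟨a, hx, h⟩

theorem mem_toSort_zeta {s : Sgn} {a : L} {z : (dualFrame A).Z s} :
    z ∈ (dualFrame A).toSort (zeta A a) s ↔ dualMem a s z := by
  cases s
  · exact Iff.rfl
  · exact mem_up_zeta A

theorem le_iff_up_le {B C : (dualFrame A).Stable} :
    B ≤ C ↔ (dualFrame A).up Sgn.one C.1 ⊆ (dualFrame A).up Sgn.one B.1 := by
  refine ⟨fun h y hy x hx => hy x (h hx), fun h x hx => ?_⟩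
  rw [← C.2]
  exact fun y hy => h hy x hx

theorem mem_up_sSup {T : Set (dualFrame A).Stable} {y : (dualFrame A).Z Sgn.del} :
    y ∈ (dualFrame A).up Sgn.one (sSup T).1 ↔ ∀ B ∈ T, y ∈ (dualFrame A).up Sgn.one B.1 := by
  change y ∈ (dualFrame A).up Sgn.one ((dualFrame A).cl Sgn.one _) ↔ _
  rw [Frame.up_cl]
  constructor
  · exact fun h B hB x hx => h x ⟨B.1, ⟨B, hB, rfl⟩, hx⟩
  · rintro h x ⟨_, ⟨B, hB, rfl⟩, hx⟩
    exact h B hB x hx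

theorem mem_sInf_zeta {S : Set L} {x : (dualFrame A).Z Sgn.one} :
    x ∈ (sInf (zeta A '' S)).1 ↔ ∀ a ∈ S, dualMem a Sgn.one x :=
  (dualFrame A).mem_sInf.trans Set.forall_mem_image

theorem mem_up_sSup_zeta {S : Set L} {y : (dualFrame A).Z Sgn.del} :
    y ∈ (dualFrame A).up Sgn.one (sSup (zeta A '' S)).1 ↔ ∀ a ∈ S, dualMem a Sgn.del y := by
  rw [mem_up_sSup, Set.forall_mem_image]
  exact forall₂_congr fun _ _ => mem_up_zeta A

theorem ofSort_eq_zeta {s : Sgn} {V : Set ((dualFrame A).Z s)} {a : L}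
    (h : ∀ t, t ∈ (dualFrame A).up s V ↔ dualMem a s.flip t) :
    (dualFrame A).ofSort s V = zeta A a := by
  cases s
  · refine Subtype.ext ((congrArg ((dualFrame A).down Sgn.one) (Set.ext fun t => ?_)).trans
      (zeta A a).2)
    exact (h t).trans (mem_up_zeta A).symm
  · refine Subtype.ext ?_
    rw [Frame.ofSort_del_val]
    exact Set.ext h

/-- Principal points realize the arguments: a value in `t` coming from elements above the generators
forces, by monotonicity, the value at the generators into `t`. -/
theorem complexOp_zeta (j : J) (a : Fin (δ j).arity → L) :
    (dualFrame A).complexOp j (fun i => zeta A (a i)) = zeta A (A.op j a) := by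
  refine ofSort_eq_zeta A fun t => (dualFrame A).mem_up_image.trans ?_
  constructor
  · intro h
    choose p hp using fun k => exists_dualPoint_principal ((δ j).inp k) (a k)
    obtain ⟨b, hb, hbt⟩ := (dualFrame_Rdual A).1
      (h p fun k => (mem_toSort_zeta A).2 ((hp k _).2 (signedLe_refl _ _)))
    exact dualMem.of_le hbt (signedLe_flip.2 ((A.isNormalOp j).mono fun k => (hp k _).1 (hb k)))
  · exact fun h p hp => (dualFrame_Rdual A).2 ⟨a, fun k => (mem_toSort_zeta A).1 (hp k), h⟩

theorem zeta_le_zeta {a b : L} : zeta A a ≤ zeta A b ↔ a ≤ b := by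
  constructor
  · intro h
    obtain ⟨x, hx⟩ := exists_dualPoint_principal Sgn.one a
    exact (hx b).1 (h ((hx a).2 (le_refl a)))
  · exact fun h x hx => dualMem.of_le (s := Sgn.one) (z := x) hx h

theorem zeta_inf (a b : L) : zeta A (a ⊓ b) = zeta A a ⊓ zeta A b :=
  le_antisymm (le_inf ((zeta_le_zeta A).2 inf_le_left) ((zeta_le_zeta A).2 inf_le_right))
    fun x hx => dualMem.signedInf (s := Sgn.one) (z := x) hx.1 hx.2

theorem zeta_sup (a b : L) : zeta A (a ⊔ b) = zeta A a ⊔ zeta A b := by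
  refine le_antisymm ((le_iff_up_le A).2 fun y hy => ?_)
    (sup_le ((zeta_le_zeta A).2 le_sup_left) ((zeta_le_zeta A).2 le_sup_right))
  exact (mem_up_zeta A).2 (dualMem.signedInf (s := Sgn.del)
    ((mem_up_zeta A).1 ((le_iff_up_le A).1 le_sup_left hy))
    ((mem_up_zeta A).1 ((le_iff_up_le A).1 le_sup_right hy)))

theorem zeta_top : zeta A ⊤ = ⊤ :=
  top_le_iff.1 fun x _ => dualMem_signedTop (s := Sgn.one) x

theorem zeta_bot : zeta A ⊥ = ⊥ :=
  le_bot_iff.1 ((le_iff_up_le A).2 fun y _ =>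
    (mem_up_zeta A).2 (dualMem_signedTop (s := Sgn.del) y))

theorem sInf_zeta_le_iff (x : (dualFrame A).Z Sgn.one) (a : L) :
    sInf (zeta A '' {b | dualMem b Sgn.one x}) ≤ zeta A a ↔ dualMem a Sgn.one x :=
  ⟨fun h => h ((mem_sInf_zeta A).2 fun _ hb => hb), fun h => sInf_le ⟨a, h, rfl⟩⟩

theorem le_sSup_zeta_iff (y : (dualFrame A).Z Sgn.del) (a : L) :
    zeta A a ≤ sSup (zeta A '' {b | dualMem b Sgn.del y}) ↔ dualMem a Sgn.del y :=
  ⟨fun h => (mem_up_zeta A).1 ((le_iff_up_le A).1 h ((mem_up_sSup_zeta A).2 fun _ hb => hb)),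
    fun h => le_sSup ⟨a, h, rfl⟩⟩

theorem sInf_zeta_le_of_mem {B : (dualFrame A).Stable} {x : (dualFrame A).Z Sgn.one}
    (hx : x ∈ B.1) : sInf (zeta A '' {b | dualMem b Sgn.one x}) ≤ B := by
  refine le_trans (fun z hz => ?_) ((dualFrame A).Gam_subset hx)
  exact (dualFrame_le A).2 ((mem_sInf_zeta A).1 hz)

theorem le_sSup_zeta_of_mem {B : (dualFrame A).Stable} {y : (dualFrame A).Z Sgn.del}
    (hy : y ∈ (dualFrame A).up Sgn.one B.1) :
    B ≤ sSup (zeta A '' {b | dualMem b Sgn.del y}) := by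
  intro x hx
  obtain ⟨b, hbx, hby⟩ := (dualFrame_gal A).1 (hy x hx)
  have h : zeta A b ≤ sSup (zeta A '' {b | dualMem b Sgn.del y}) := le_sSup ⟨b, hby, rfl⟩
  exact h hbx

/-- Compactness of the representation, with an interpolating element of the image. -/
theorem zeta_compact (T U : Set (dualFrame A).Stable) (hT : ∀ k ∈ T, IsClosedElt (zeta A) k)
    (hU : ∀ o ∈ U, IsOpenElt (zeta A) o) (h : sInf T ≤ sSup U) :
    ∃ T₁ U₁ : Set (dualFrame A).Stable, ∃ a : L, T₁ ⊆ T ∧ U₁ ⊆ U ∧ T₁.Finite ∧ U₁.Finite ∧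
      sInf T₁ ≤ zeta A a ∧ zeta A a ≤ sSup U₁ := by
  -- The filter of elements above a finite meet from `T`; `y` below is the ideal of elements under a
  -- finite join from `U`.
  obtain ⟨x, hx⟩ := exists_dualPoint Sgn.one
    {a : L | ∃ T₁ : Set (dualFrame A).Stable, T₁ ⊆ T ∧ T₁.Finite ∧ sInf T₁ ≤ zeta A a}
    ⟨∅, Set.empty_subset _, Set.finite_empty, (zeta_top A).symm ▸ le_top⟩
    (by
      rintro a ⟨P, hP, hPf, hPa⟩ b ⟨Q, hQ, hQf, hQb⟩
      refine ⟨P ∪ Q, Set.union_subset hP hQ, hPf.union hQf, ?_⟩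
      change _ ≤ zeta A (a ⊓ b)
      rw [zeta_inf, sInf_union]
      exact inf_le_inf hPa hQb)
    (fun a ⟨P, hP, hPf, hPa⟩ b hab => ⟨P, hP, hPf, hPa.trans ((zeta_le_zeta A).2 hab)⟩)
  obtain ⟨y, hy⟩ := exists_dualPoint Sgn.del
    {a : L | ∃ U₁ : Set (dualFrame A).Stable, U₁ ⊆ U ∧ U₁.Finite ∧ zeta A a ≤ sSup U₁}
    ⟨∅, Set.empty_subset _, Set.finite_empty, (zeta_bot A).le.trans bot_le⟩
    (by
      rintro a ⟨P, hP, hPf, hPa⟩ b ⟨Q, hQ, hQf, hQb⟩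
      refine ⟨P ∪ Q, Set.union_subset hP hQ, hPf.union hQf, ?_⟩
      change zeta A (a ⊔ b) ≤ _
      rw [zeta_sup, sSup_union]
      exact sup_le_sup hPa hQb)
    (fun a ⟨P, hP, hPf, hPa⟩ b hab => ⟨P, hP, hPf, ((zeta_le_zeta A).2 hab).trans hPa⟩)
  have hxT : x ∈ (sInf T).1 := by
    refine (dualFrame A).mem_sInf.2 fun k hk => ?_
    obtain ⟨S, rfl⟩ := hT k hk
    refine (mem_sInf_zeta A).2 fun a ha => (hx a).2 ⟨{_}, Set.singleton_subset_iff.2 hk,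
      Set.finite_singleton _, ?_⟩
    rw [sInf_singleton]
    exact sInf_le ⟨a, ha, rfl⟩
  have hyU : y ∈ (dualFrame A).up Sgn.one (sSup U).1 := by
    refine (mem_up_sSup A).2 fun o ho => ?_
    obtain ⟨S, rfl⟩ := hU o ho
    refine (mem_up_sSup_zeta A).2 fun a ha => (hy a).2 ⟨{_}, Set.singleton_subset_iff.2 ho,
      Set.finite_singleton _, ?_⟩
    rw [sSup_singleton]
    exact le_sSup ⟨a, ha, rfl⟩
  -- Since `x` lies in `sInf T` and `y` in the polar of `sSup U`, the inequality makes them share an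
  -- element, the interpolant.
  obtain ⟨a, hax, hay⟩ := (dualFrame_gal A).1 ((le_iff_up_le A).1 h hyU x hxT)
  obtain ⟨T₁, hT₁, hTf, hTa⟩ := (hx a).1 hax
  obtain ⟨U₁, hU₁, hUf, hUa⟩ := (hy a).1 hay
  exact ⟨T₁, U₁, a, hT₁, hU₁, hTf, hUf, hTa, hUa⟩

theorem isCanonicalExtension_zeta : IsCanonicalExtension (zeta A) where
  injective a b h := le_antisymm ((zeta_le_zeta A).1 h.le) ((zeta_le_zeta A).1 h.ge)
  map_sup := zeta_sup A
  map_inf := zeta_inf A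
  map_bot := zeta_bot A
  map_top := zeta_top A
  dense_inf c := by
    refine ⟨(fun y : (dualFrame A).Z Sgn.del => sSup (zeta A '' {b | dualMem b Sgn.del y})) ''
      (dualFrame A).up Sgn.one c.1, ?_, le_antisymm (le_sInf ?_) ?_⟩
    · rintro _ ⟨y, -, rfl⟩
      exact ⟨_, rfl⟩
    · rintro _ ⟨y, hy, rfl⟩
      exact le_sSup_zeta_of_mem A hy
    · refine (le_iff_up_le A).2 fun y hy => ?_
      have h := sInf_le (Set.mem_image_of_mem
        (fun y : (dualFrame A).Z Sgn.del => sSup (zeta A '' {b | dualMem b Sgn.del y})) hy)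
      exact (le_iff_up_le A).1 h ((mem_up_sSup_zeta A).2 fun _ hb => hb)
  dense_sup c := by
    refine ⟨(fun x : (dualFrame A).Z Sgn.one => sInf (zeta A '' {b | dualMem b Sgn.one x})) ''
      c.1, ?_, le_antisymm ?_ (sSup_le ?_)⟩
    · rintro _ ⟨x, -, rfl⟩
      exact ⟨_, rfl⟩
    · intro x hx
      have h := le_sSup (Set.mem_image_of_mem
        (fun x : (dualFrame A).Z Sgn.one => sInf (zeta A '' {b | dualMem b Sgn.one x})) hx)
      exact h ((mem_sInf_zeta A).2 fun _ hb => hb)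
    · rintro _ ⟨x, hx, rfl⟩
      exact sInf_zeta_le_of_mem A hx
  compact T U hT hU := by
    constructor
    · intro h
      obtain ⟨T₁, U₁, a, hT₁, hU₁, hTf, hUf, hTa, hUa⟩ := zeta_compact A T U hT hU h
      exact ⟨T₁, U₁, hT₁, hU₁, hTf, hUf, hTa.trans hUa⟩
    · rintro ⟨T₁, U₁, hT₁, hU₁, -, -, h⟩
      exact (sInf_le_sInf hT₁).trans (h.trans (sSup_le_sSup hU₁))

/-! ### Complex operations as σ- and π-extensions. -/

theorem exists_zeta_between {k o : (dualFrame A).Stable} (hk : IsClosedElt (zeta A) k)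
    (ho : IsOpenElt (zeta A) o) (h : k ≤ o) : ∃ a : L, k ≤ zeta A a ∧ zeta A a ≤ o := by
  obtain ⟨T₁, U₁, a, hT₁, hU₁, -, -, hTa, hUa⟩ := zeta_compact A {k} {o}
    (by rintro _ rfl; exact hk) (by rintro _ rfl; exact ho)
    (by rwa [sInf_singleton, sSup_singleton])
  refine ⟨a, le_trans ?_ hTa, hUa.trans ?_⟩
  · simpa using sInf_le_sInf hT₁
  · simpa using sSup_le_sSup hU₁

/-- The point is the filter of elements above `k`, or the ideal of elements below `o`. Its elements
may violate the other bound; combining them with an interpolant `c` between `k` and `o` brings them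
into the interval. -/
theorem exists_mem_toSort_between (s : Sgn) {k o B : (dualFrame A).Stable}
    (hk : IsClosedElt (zeta A) k) (ho : IsOpenElt (zeta A) o) (hkB : k ≤ B) (hBo : B ≤ o) :
    ∃ z ∈ (dualFrame A).toSort B s, ∀ a : L, dualMem a s z →
      ∃ b : L, (k ≤ zeta A b ∧ zeta A b ≤ o) ∧ signedLe s b a := by
  obtain ⟨c, hkc, hco⟩ := exists_zeta_between A hk ho (hkB.trans hBo)
  cases s
  · obtain ⟨x, hx⟩ := exists_dualPoint Sgn.one {a : L | k ≤ zeta A a}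
      (le_top.trans (zeta_top A).ge)
      (fun a ha b hb => (le_inf ha hb).trans (zeta_inf A a b).ge)
      fun a ha b hab => le_trans ha ((zeta_le_zeta A).2 hab)
    refine ⟨x, hkB ?_, fun a ha => ⟨a ⊓ c, ⟨?_, ?_⟩, inf_le_left⟩⟩
    · obtain ⟨S, rfl⟩ := hk
      exact (mem_sInf_zeta A).2 fun a ha => (hx a).2 (sInf_le (Set.mem_image_of_mem (zeta A) ha))
    · exact (le_inf ((hx a).1 ha) hkc).trans (zeta_inf A a c).ge
    · exact ((zeta_le_zeta A).2 inf_le_right).trans hco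
  · obtain ⟨y, hy⟩ := exists_dualPoint Sgn.del {a : L | zeta A a ≤ o}
      ((zeta_bot A).le.trans bot_le)
      (fun a ha b hb => (zeta_sup A a b).le.trans (sup_le ha hb))
      fun a ha b hab => ((zeta_le_zeta A).2 hab).trans ha
    refine ⟨y, (le_iff_up_le A).1 hBo ?_, fun a ha => ⟨a ⊔ c, ⟨?_, ?_⟩, le_sup_left (α := L)⟩⟩
    · obtain ⟨S, rfl⟩ := ho
      exact (mem_up_sSup_zeta A).2 fun a ha => (hy a).2 (le_sSup (Set.mem_image_of_mem (zeta A) ha))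
    · exact hkc.trans ((zeta_le_zeta A).2 le_sup_right)
    · exact (zeta_sup A a c).le.trans (sup_le ((hy a).1 ha) hco)

/-- A point imposes a bound on one side only: a filter yields a closed `k`, an ideal an open `o`,
and the other bound is taken trivial. -/
theorem exists_between_of_mem_toSort (s : Sgn) {B : (dualFrame A).Stable}
    {z : (dualFrame A).Z s} (hz : z ∈ (dualFrame A).toSort B s) :
    ∃ k o : (dualFrame A).Stable, IsClosedElt (zeta A) k ∧ IsOpenElt (zeta A) o ∧ k ≤ B ∧ B ≤ o ∧
      ∀ a : L, k ≤ zeta A a → zeta A a ≤ o → dualMem a s z := by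
  cases s
  · refine ⟨sInf (zeta A '' {b | dualMem b Sgn.one z}), ⊤, ⟨_, rfl⟩, ⟨{⊤}, by rw [Set.image_singleton, sSup_singleton, zeta_top]⟩,
      sInf_zeta_le_of_mem A hz, le_top, fun a ha _ => (sInf_zeta_le_iff A z a).1 ha⟩
  · refine ⟨⊥, sSup (zeta A '' {b | dualMem b Sgn.del z}), ⟨{⊥}, by rw [Set.image_singleton, sInf_singleton, zeta_bot]⟩, ⟨_, rfl⟩,
      bot_le, le_sSup_zeta_of_mem A hz, fun a _ ha => (le_sSup_zeta_iff A z a).1 ha⟩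

/-- The points of sort `s` that contain all members of `S`. -/
def pointsContaining (s : Sgn) (S : Set L) : Set ((dualFrame A).Z s) :=
  {z | ∀ a ∈ S, dualMem a s z}

theorem ofSort_pointsContaining_eq_sInf {s : Sgn} (hs : s = Sgn.one) (S : Set L) :
    (dualFrame A).ofSort s (pointsContaining A s S) = sInf (zeta A '' S) := by
  subst hs
  have h : pointsContaining A Sgn.one S = (sInf (zeta A '' S)).1 :=
    Set.ext fun z => (mem_sInf_zeta A).symm
  rw [h]
  exact Subtype.ext (sInf (zeta A '' S)).2

theorem ofSort_pointsContaining_eq_sSup {s : Sgn} (hs : s = Sgn.del) (S : Set L) :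
    (dualFrame A).ofSort s (pointsContaining A s S) = sSup (zeta A '' S) := by
  subst hs
  have h : pointsContaining A Sgn.del S =
      (dualFrame A).up Sgn.one (sSup (zeta A '' S)).1 :=
    Set.ext fun z => (mem_up_sSup_zeta A).symm
  refine Subtype.ext (((dualFrame A).ofSort_del_val _).trans ?_)
  rw [h]
  exact (sSup (zeta A '' S)).2

/-- The values of the operator `A.op j` at the tuples that belong to `p`. -/
def sectionValues (j : J) (p : ∀ k, (dualFrame A).Z ((δ j).inp k)) : Set L :=
  {b | ∃ a : Fin (δ j).arity → L, (∀ k, dualMem (a k) ((δ j).inp k) (p k)) ∧ b = A.op j a}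

/-- Writes the image as a union over argument tuples, so that its closure becomes a join, or for
output sort `∂` a meet, of elements known explicitly. -/
theorem dualFrame_image_eq (j : J) (W : ∀ k, Set ((dualFrame A).Z ((δ j).inp k))) :
    (dualFrame A).image j W = {z | ∃ p ∈ {p : ∀ k, (dualFrame A).Z ((δ j).inp k) |
      ∀ k, p k ∈ W k}, z ∈ pointsContaining A (δ j).out (sectionValues A j p)} := by
  ext z
  refine exists_congr fun p => ⟨fun ⟨h, hp⟩ => ⟨hp, ?_⟩, fun ⟨hp, h⟩ => ⟨fun a ha => ?_, hp⟩⟩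
  · rintro _ ⟨a, ha, rfl⟩
    exact h a ha
  · exact h _ ⟨a, ha, rfl⟩

theorem exists_section_between (j : J) {k o B : Fin (δ j).arity → (dualFrame A).Stable}
    (hk : ∀ i, IsClosedElt (zeta A) (k i)) (ho : ∀ i, IsOpenElt (zeta A) (o i)) (hkB : k ≤ B)
    (hBo : B ≤ o) :
    ∃ p : ∀ i, (dualFrame A).Z ((δ j).inp i),
      (∀ i, p i ∈ (dualFrame A).toSort (B i) ((δ j).inp i)) ∧
      ∀ b ∈ sectionValues A j p, ∃ a : Fin (δ j).arity → L,
        (∀ i, k i ≤ zeta A (a i)) ∧ (∀ i, zeta A (a i) ≤ o i) ∧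
          signedLe (δ j).out (A.op j a) b := by
  choose p hpB hp using fun i =>
    exists_mem_toSort_between A ((δ j).inp i) (hk i) (ho i) (hkB i) (hBo i)
  refine ⟨p, hpB, ?_⟩
  rintro _ ⟨b, hb, rfl⟩
  choose a ha hab using fun i => hp i (b i) (hb i)
  exact ⟨a, fun i => (ha i).1, fun i => (ha i).2, (A.isNormalOp j).mono hab⟩

theorem exists_between_of_section (j : J) {B : Fin (δ j).arity → (dualFrame A).Stable}
    {p : ∀ i, (dualFrame A).Z ((δ j).inp i)}
    (hp : ∀ i, p i ∈ (dualFrame A).toSort (B i) ((δ j).inp i)) :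
    ∃ k o : Fin (δ j).arity → (dualFrame A).Stable, (∀ i, IsClosedElt (zeta A) (k i)) ∧
      (∀ i, IsOpenElt (zeta A) (o i)) ∧ k ≤ B ∧ B ≤ o ∧
      ∀ a : Fin (δ j).arity → L, (∀ i, k i ≤ zeta A (a i)) → (∀ i, zeta A (a i) ≤ o i) →
        A.op j a ∈ sectionValues A j p := by
  choose k o hk ho hkB hBo h using fun i => exists_between_of_mem_toSort A ((δ j).inp i) (hp i)
  exact ⟨k, o, hk, ho, hkB, hBo, fun a ha ha' => ⟨a, fun i => h i (a i) (ha i) (ha' i), rfl⟩⟩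

/-- Both sides are joins of meets of values. Each tuple of points is dominated by a pair of bounds
and conversely, so the joins agree. -/
theorem complexOp_eq_sigmaExt (j : J) (hj : (δ j).out = Sgn.one) :
    (dualFrame A).complexOp j = sigmaExt (zeta A) (A.op j) := by
  funext B
  rw [Frame.complexOp, dualFrame_image_eq, Frame.ofSort_eq_sSup _ hj]
  simp only [ofSort_pointsContaining_eq_sInf A hj]
  refine le_antisymm (sSup_le ?_) (sSup_le ?_)
  · rintro _ ⟨p, hp, rfl⟩
    obtain ⟨k, o, hk, ho, hkB, hBo, h⟩ := exists_between_of_section A j hp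
    refine le_trans (le_sInf ?_) (le_sSup ⟨k, o, hk, ho, hkB, hBo, rfl⟩)
    rintro _ ⟨a, hka, hao, rfl⟩
    exact sInf_le ⟨_, h a hka hao, rfl⟩
  · rintro _ ⟨k, o, hk, ho, hkB, hBo, rfl⟩
    obtain ⟨p, hp, h⟩ := exists_section_between A j hk ho hkB hBo
    refine le_trans (le_sInf ?_) (le_sSup ⟨p, hp, rfl⟩)
    rintro _ ⟨b, hb, rfl⟩
    obtain ⟨a, hka, hao, hab⟩ := h b hb
    rw [hj] at hab
    exact le_trans (sInf_le ⟨a, hka, hao, rfl⟩) ((zeta_le_zeta A).2 hab)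

theorem complexOp_eq_piExt (j : J) (hj : (δ j).out = Sgn.del) :
    (dualFrame A).complexOp j = piExt (zeta A) (A.op j) := by
  funext B
  rw [Frame.complexOp, dualFrame_image_eq, Frame.ofSort_eq_sInf _ hj]
  simp only [ofSort_pointsContaining_eq_sSup A hj]
  refine le_antisymm (le_sInf ?_) (le_sInf ?_)
  · rintro _ ⟨k, o, hk, ho, hkB, hBo, rfl⟩
    obtain ⟨p, hp, h⟩ := exists_section_between A j hk ho hkB hBo
    refine le_trans (sInf_le ⟨p, hp, rfl⟩) (sSup_le ?_)
    rintro _ ⟨b, hb, rfl⟩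
    obtain ⟨a, hka, hao, hab⟩ := h b hb
    rw [hj] at hab
    exact le_trans ((zeta_le_zeta A).2 hab) (le_sSup ⟨a, hka, hao, rfl⟩)
  · rintro _ ⟨p, hp, rfl⟩
    obtain ⟨k, o, hk, ho, hkB, hBo, h⟩ := exists_between_of_section A j hp
    refine le_trans (sInf_le ⟨k, o, hk, ho, hkB, hBo, rfl⟩) (sSup_le ?_)
    rintro _ ⟨a, hka, hao, rfl⟩
    exact le_sSup ⟨_, h a hka hao, rfl⟩

theorem isCanonicalExtensionNLE_zeta :
    IsCanonicalExtensionNLE A (dualFrame A).complexOp (zeta A) where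
  lattice := isCanonicalExtension_zeta A
  isNormalOp := (dualFrame A).isNormalOp_complexOp (dualFrame_smooth A)
  extends_op := complexOp_zeta A
  eq_sigmaExt := complexOp_eq_sigmaExt A
  eq_piExt := complexOp_eq_piExt A

end DualFrame

/-! ### Implicative modal lattices: the refined frame conditions. -/

section Modal

variable {L : Type u} [Lattice L] [BoundedOrder L] (M : ImplicativeModalLattice L)

theorem ImplicativeModalLattice.box_mono {a b : L} (h : a ≤ b) : M.box a ≤ M.box b := by
  rw [← inf_eq_left, ← M.box_inf, inf_eq_left.2 h]

theorem exists_box_preimage (x : (dualFrame M.toNLE).Z Sgn.one) :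
    ∃ z : (dualFrame M.toNLE).Z Sgn.one, ∀ a : L, dualMem a Sgn.one z ↔
      dualMem (M.box a) Sgn.one x := by
  refine exists_dualPoint Sgn.one {a : L | dualMem (M.box a) Sgn.one x} ?_ ?_ ?_
  · change dualMem (M.box ⊤) Sgn.one x
    rw [M.box_top]
    exact dualMem_signedTop (s := Sgn.one) x
  · intro a ha b hb
    change dualMem (M.box (a ⊓ b)) Sgn.one x
    rw [M.box_inf]
    exact dualMem.signedInf (s := Sgn.one) ha hb
  · exact fun a ha b hab => dualMem.of_le (s := Sgn.one) ha (M.box_mono hab)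

/-- The left adjoint on filters of the preimage under `□`: the filter generated by `□[x]` is
contained in `z` iff `x ⊆ □⁻¹[z]`. This filter generates the closed element in (F5). -/
theorem exists_box_image (x : (dualFrame M.toNLE).Z Sgn.one) :
    ∃ z : (dualFrame M.toNLE).Z Sgn.one, ∀ b : L, dualMem b Sgn.one z ↔
      ∃ a : L, dualMem a Sgn.one x ∧ M.box a ≤ b := by
  refine exists_dualPoint Sgn.one {b : L | ∃ a : L, dualMem a Sgn.one x ∧ M.box a ≤ b} ?_ ?_ ?_
  · exact ⟨⊤, dualMem_signedTop (s := Sgn.one) x, le_top⟩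
  · rintro b ⟨a, ha, hab⟩ c ⟨a', ha', hac⟩
    exact ⟨a ⊓ a', dualMem.signedInf (s := Sgn.one) ha ha',
      le_inf ((M.box_mono inf_le_left).trans hab) ((M.box_mono inf_le_right).trans hac)⟩
  · rintro b ⟨a, ha, hab⟩ c hbc
    exact ⟨a, ha, le_trans hab hbc⟩

theorem boxDual_iff {x : (dualFrame M.toNLE).Z Sgn.one} {y : (dualFrame M.toNLE).Z Sgn.del} :
    boxDual (dualFrame M.toNLE) x y ↔
      ∃ a : L, dualMem a Sgn.del y ∧ dualMem (M.box a) Sgn.one x := by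
  refine (dualFrame_Rdual M.toNLE).trans ⟨?_, ?_⟩
  · rintro ⟨a, ha, hax⟩
    exact ⟨a (0 : Fin 1), ha (0 : Fin 1), hax⟩
  · rintro ⟨a, ha, hax⟩
    exact ⟨fun _ => a, fun _ => ha, hax⟩

theorem boxDual_iff_gal {x z : (dualFrame M.toNLE).Z Sgn.one}
    (hz : ∀ a : L, dualMem a Sgn.one z ↔ dualMem (M.box a) Sgn.one x)
    {y : (dualFrame M.toNLE).Z Sgn.del} :
    boxDual (dualFrame M.toNLE) x y ↔ (dualFrame M.toNLE).gal Sgn.one z y := by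
  refine (boxDual_iff M).trans (Iff.trans ?_ (dualFrame_gal M.toNLE).symm)
  exact exists_congr fun a => by rw [hz, and_comm]; rfl

/-- `R'_□` relates `x` to the ideals meeting `□⁻¹[x]`, so the double dual section is the double
polar of that single filter. -/
theorem boxDoubleDual_eq {x z : (dualFrame M.toNLE).Z Sgn.one}
    (hz : ∀ a : L, dualMem a Sgn.one z ↔ dualMem (M.box a) Sgn.one x) :
    boxDoubleDual (dualFrame M.toNLE) x = (dualFrame M.toNLE).Gam Sgn.one z := by
  ext t
  constructor
  · intro h y hy _ ht
    rw [Set.mem_singleton_iff.1 ht]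
    exact h y ((boxDual_iff_gal M hz).2 (hy z rfl))
  · intro h y hy
    refine h (fun _ hw => ?_) t rfl
    rw [Set.mem_singleton_iff.1 hw]
    exact (boxDual_iff_gal M hz).1 hy

/-- A stable set `B` contains `z` iff `z` is Galois related to all of `B'`, and for `z = □⁻¹[x]`
this is `R'_□` at `x`. -/
theorem mem_boxOp_iff {x z : (dualFrame M.toNLE).Z Sgn.one}
    (hz : ∀ a : L, dualMem a Sgn.one z ↔ dualMem (M.box a) Sgn.one x)
    {B : (dualFrame M.toNLE).Stable} :
    x ∈ (boxOp (dualFrame M.toNLE) B).1 ↔ z ∈ B.1 := by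
  have h : x ∈ (boxOp (dualFrame M.toNLE) B).1 ↔
      ∀ y ∈ (dualFrame M.toNLE).up Sgn.one B.1, boxDual (dualFrame M.toNLE) x y := by
    refine (Set.ext_iff.1 ((dualFrame M.toNLE).ofSort_del_val _) x).trans
      (((dualFrame M.toNLE).mem_up_image (j := ModalIdx.box) (t := x)).trans ?_)
    exact ⟨fun h y hy => h (fun _ => y) fun _ => hy, fun h p hp => by
      have := h (p (0 : Fin 1)) (hp (0 : Fin 1))
      have e : p = fun _ => p (0 : Fin 1) := funext fun i => by
        rw [Subsingleton.elim (α := Fin 1) i 0]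
      rw [e]
      exact this⟩
  rw [h]
  conv_rhs => rw [← B.2]
  exact forall₂_congr fun y _ => boxDual_iff_gal M hz

theorem isRefinedFrame_dualFrame : IsRefinedFrame (dualFrame M.toNLE) where
  separated := dualFrame_separated M.toNLE
  increasing j z t p hzt hz a ha := (dualFrame_le M.toNLE).1 hzt _ (hz a ha)
  decreasing j z p k t htp hz a ha := by
    refine hz a fun i => ?_
    rcases eq_or_ne i k with rfl | hi
    · exact (dualFrame_le M.toNLE).1 htp _ (by simpa using ha i)
    · simpa [hi] using ha i
  closed_section := dualFrame_closed_section M.toNLE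
  smooth := dualFrame_smooth M.toNLE
  box_closed x := by
    obtain ⟨t, ht⟩ := exists_box_image M x
    refine ⟨t, Set.ext fun z => ?_⟩
    obtain ⟨w, hw⟩ := exists_box_preimage M z
    rw [Set.mem_ofPred_eq, boxDoubleDual_eq M hw]
    constructor
    · intro h
      refine (dualFrame_le M.toNLE).2 fun b hb => ?_
      obtain ⟨a, ha, hab⟩ := (ht b).1 hb
      exact dualMem.of_le (s := Sgn.one) ((hw a).1
        ((dualFrame_le M.toNLE).1 (h (Set.Subset.refl _ : w ∈ _)) a ha)) hab
    · intro h
      refine (dualFrame M.toNLE).Gam_subset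
        (A := (dualFrame M.toNLE).GamS x) ((dualFrame_le M.toNLE).2 fun a ha => (hw a).2 ?_)
      exact (dualFrame_le M.toNLE).1 h _ ((ht _).2 ⟨a, ha, le_refl _⟩)
  box_iSup B := by
    -- The join on the left is `B` itself. For `x` in `□B` the filter `z = □⁻¹[x]` lies in `B`, and
    -- `x` already belongs to the single joinand `□(Γ z)`.
    rw [Frame.iSup_Gam]
    intro x hx
    obtain ⟨z, hz⟩ := exists_box_preimage M x
    have h : boxOp (dualFrame M.toNLE) ((dualFrame M.toNLE).GamS z) ≤
        ⨆ x ∈ B.1, boxOp (dualFrame M.toNLE) ((dualFrame M.toNLE).GamS x) :=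
      le_iSup₂ (f := fun x _ => boxOp (dualFrame M.toNLE) ((dualFrame M.toNLE).GamS x)) z
        ((mem_boxOp_iff M hz).1 hx)
    exact h ((mem_boxOp_iff M hz).2 (Set.Subset.refl _))

end Modal

theorem mainTheorem1 :
    (∀ {J : Type v} {δ : J → DistType} {L : Type u} [Lattice L] [BoundedOrder L] (A : NLE δ L),
      (dualFrame A).Separated ∧ (dualFrame A).Smooth ∧
        IsCanonicalExtensionNLE A (dualFrame A).complexOp (zeta A)) ∧
    (∀ {L : Type u} [Lattice L] [BoundedOrder L] (M : ImplicativeModalLattice L),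
      IsRefinedFrame (dualFrame M.toNLE)) :=
  ⟨fun A => ⟨dualFrame_separated A, dualFrame_smooth A, isCanonicalExtensionNLE_zeta A⟩,
    fun M => isRefinedFrame_dualFrame M⟩
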